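/- Let $f:\mathbb{R}^{n+p}\to\mathbb{R}^n$ have continuous second order partial derivatives, and consider the system $x_{k+1}=f(z_k)+w_k$ with $z_k=[x_k'\ u_k']'$, $x_k\in\mathbb{R}^n$, $u_k\in\mathbb{R}^p$. Let $[A\ B]$ be the Jacobian of $f$ at the origin (with $A\in\mathbb{R}^{n\times n}$, $B\in\mathbb{R}^{n\times p}$), $o=f(\mathbf 0)$, $\Theta=[A\ B\ o]\in\mathbb{R}^{n\times(n+p+1)}$, and let $h(z)=f(z)-Ax-Bu-o$ for $z=[x'\ u']'$ be the remainder. Let $c>0$ and $\beta$ be such that $|h_i(z)|\le\beta\|z\|_1^2$ for all $i\in\{1,\dots,n\}$ and all $z\in\mathbb{R}^{n+p}$ with $\|z\|_1<c$. Data acquisition. Let $q>0$. The initial conditions $z_0^1,\dots,z_0^N\in\mathbb{R}^{n+p}$ of $N$ experiments are chosen deterministically: with $s_1=1$, for $i=1,\dots,N$, if $i\bmod (n+p)\ne 0$, then $z_0^i=s_i\,q\,e_{i\bmod (n+p)}$ and $s_{i+1}=s_i$; otherwise $z_0^i=s_i\,q\,e_{n+p}$ and $s_{i+1}=-s_i$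 (here $e_1,\dots,e_{n+p}$ is the standard basis of $\mathbb{R}^{n+p}$). In experiment $i$ one observes $x_1^i=f(z_0^i)+w_0^i$, where $w_0^1,\dots,w_0^N$ are independent random vectors in $\mathbb{R}^n$ that are sub-Gaussian with parameter $\sigma_w^2$, $\sigma_w\ge 0$, i.e. $\mathbb{E}\exp(\alpha v'w_0^i)\le\exp(\alpha^2\sigma_w^2/2)$ for all $\alpha\in\mathbb{R}$ and all unit vectors $v\in\mathbb{R}^n$. Estimation. Let $X=[x_1^1\cdots x_1^N]$, let $Z\in\mathbb{R}^{(n+p+1)\times N}$ have the columns $[z_0^{i\prime}\ 1]'$, and, for $\lambda\ge 0$, let $\hat\Theta=XZ'(ZZ'+\lambda I_{n+p+1})^{-1}$. Theorem. Let $N\ge 4(n+p)$, $q\le\sqrt{n+p}$, $q<c$ and $\delta\in(0,1)$, and put $\gamma=\frac{\lambda(n+p)}{Nq^2}$. Then $ZZ'+\lambda I_{n+p+1}$ is invertible and, with probability at least $1-\delta$, $$\|\hat\Theta-\Theta\|\le\frac{5\sigma_w\sqrt{\log\frac{9^n}{\delta}+(n+p+1)\log\!\left(1+\frac{4(n+p)}{q^2}\right)}}{\sqrt{Nq^2/(n+p)+\lambda}}+\sqrt{\frac{2(n^2+np)}{1+\gamma}}\,\beta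 q+\frac{2(n+p)\left(\lambda\|\Theta\|+\sqrt{\lambda Nn\beta^2q^4}\right)}{2\lambda(n+p)+Nq^2},$$ where $\|\cdot\|$ is the spectral norm. -/

import Mathlib

open MeasureTheory ProbabilityTheory
open scoped NNReal Matrix Matrix.Norms.L2Operator

noncomputable section

namespace LinearizedSysId

/-- A random vector `w` in `ℝⁿ` is `σ²` sub-Gaussian: for every vector `v` of Euclidean norm `1`,
the real random variable `v' w` satisfies `𝔼 exp (α v' w) ≤ exp (α² σ² / 2)` for all real `α`
(the expectation being finite). -/
def IsSubGaussianVector {Ω : Type*} [MeasurableSpace Ω] {n : ℕ} (w : Ω → Fin n → ℝ) (σ : ℝ≥0)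
    (μ : Measure Ω) : Prop :=
  ∀ v : Fin n → ℝ, v ⬝ᵥ v = 1 → HasSubgaussianMGF (fun ω => v ⬝ᵥ w ω) (σ ^ 2) μ

/-- The `ℓ₁` norm of a vector. -/
def l1Norm {d : ℕ} (z : Fin d → ℝ) : ℝ := ∑ j, |z j|

section System

variable {n p : ℕ}

/-- The state part `x` of `z = [x' u']'`. -/
def statePart (z : Fin (n + p) → ℝ) : Fin n → ℝ := fun j => z (Fin.castAdd p j)

/-- The input part `u` of `z = [x' u']'`. -/
def inputPart (z : Fin (n + p) → ℝ) : Fin p → ℝ := fun j => z (Fin.natAdd n j)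

/-- The matrix `A` of the linear part of `f` at the origin: the Jacobian in the state. -/
def matA (f : (Fin (n + p) → ℝ) → (Fin n → ℝ)) : Matrix (Fin n) (Fin n) ℝ :=
  Matrix.of fun i j => fderiv ℝ f 0 (Pi.single (Fin.castAdd p j) 1) i

/-- The matrix `B` of the linear part of `f` at the origin: the Jacobian in the input. -/
def matB (f : (Fin (n + p) → ℝ) → (Fin n → ℝ)) : Matrix (Fin n) (Fin p) ℝ :=
  Matrix.of fun i j => fderiv ℝ f 0 (Pi.single (Fin.natAdd n j) 1) i

/-- The offset `o = f 0`. -/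
def offset (f : (Fin (n + p) → ℝ) → (Fin n → ℝ)) : Fin n → ℝ := f 0

/-- The remainder `h`, determined by `f z = A x + B u + o + h z` for `z = [x' u']'`. -/
def remainder (f : (Fin (n + p) → ℝ) → (Fin n → ℝ)) (z : Fin (n + p) → ℝ) : Fin n → ℝ :=
  f z - (matA f *ᵥ statePart z + matB f *ᵥ inputPart z + offset f)

/-- `c` and `β` satisfy the remainder assumption: `c > 0` and every component of the remainder is
at most `β ‖z‖₁²` in absolute value on the open `ℓ₁` ball of radius `c` about the origin. -/
def RemainderBound (f : (Fin (n + p) → ℝ) → (Fin n → ℝ)) (c β : ℝ) : Prop :=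
  0 < c ∧ ∀ z : Fin (n + p) → ℝ, l1Norm z < c → ∀ i, |remainder f z i| ≤ β * l1Norm z ^ 2

/-- The block matrix `Θ = [A B o]`. -/
def theta (f : (Fin (n + p) → ℝ) → (Fin n → ℝ)) : Matrix (Fin n) (Fin (n + p + 1)) ℝ :=
  Matrix.of fun i =>
    (Fin.snoc (Fin.append (matA f i) (matB f i)) (offset f i) : Fin (n + p + 1) → ℝ)

end System

section DataAcquisition

/-- The vector `e_m` in `ℝᵈ`, for `m` in `{1, …, d}` (numbering of the coordinates from `1`). -/
def basisVec (d m : ℕ) : Fin d → ℝ := fun j => if (j : ℕ) + 1 = m then 1 else 0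

/-- The signs `s_i`, `i ≥ 1`, of the data acquisition scheme in dimension `d`: `s_1 = 1`, and
`s_{i+1}` is `s_i` if `i mod d ≠ 0` and `-s_i` otherwise. The value at `0` is never used. -/
def sign (d : ℕ) : ℕ → ℝ
  | 0 => 1
  | 1 => 1
  | (i + 2) => if (i + 1) % d ≠ 0 then sign d (i + 1) else -sign d (i + 1)

/-- The initial condition of experiment `i ≥ 1` in dimension `d`:
`s_i q e_{i mod d}` if `i mod d ≠ 0`, and `s_i q e_d` otherwise. -/
def initialCondition (d : ℕ) (q : ℝ) (i : ℕ) : Fin d → ℝ :=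
  if i % d ≠ 0 then (sign d i * q) • basisVec d (i % d) else (sign d i * q) • basisVec d d

variable {n p N : ℕ}

/-- The matrix `X` whose `t`-th column is the state `f (z₀) + w₀` reached after one step of
experiment `t`. Experiments `1, …, N` correspond to the elements `0, …, N - 1` of `Fin N`;
`w t` is the noise of the corresponding experiment. -/
def dataX (f : (Fin (n + p) → ℝ) → (Fin n → ℝ)) (q : ℝ) (w : Fin N → Fin n → ℝ) :
    Matrix (Fin n) (Fin N) ℝ :=
  Matrix.of fun i t => f (initialCondition (n + p) q ((t : ℕ) + 1)) i + w t i

/-- The regressor matrix `Z` whose `t`-th column is `[z₀' 1]'`, for `z₀` the initial condition of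
experiment `t`. -/
def regZ (n p N : ℕ) (q : ℝ) : Matrix (Fin (n + p + 1)) (Fin N) ℝ :=
  Matrix.of fun a t =>
    (Fin.snoc (initialCondition (n + p) q ((t : ℕ) + 1)) 1 : Fin (n + p + 1) → ℝ) a

/-- The regularized Gram matrix `Z Z' + lam I`. -/
def gram (n p N : ℕ) (q lam : ℝ) : Matrix (Fin (n + p + 1)) (Fin (n + p + 1)) ℝ :=
  regZ n p N q * (regZ n p N q)ᵀ + lam • (1 : Matrix (Fin (n + p + 1)) (Fin (n + p + 1)) ℝ)

/-- The regularized least squares estimate `X Z' (Z Z' + lam I)⁻¹`. -/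
def thetaHat (f : (Fin (n + p) → ℝ) → (Fin n → ℝ)) (q lam : ℝ) (w : Fin N → Fin n → ℝ) :
    Matrix (Fin n) (Fin (n + p + 1)) ℝ :=
  dataX f q w * (regZ n p N q)ᵀ * (gram n p N q lam)⁻¹

end DataAcquisition

end LinearizedSysId

end

open LinearizedSysId

/-! Write G = ZZ' + λI, K = Z'G⁻¹, d = n + p, and let W and H collect the noises and the remainders.
Since X = ΘZ + H + W and ZZ' = G - λI, the error is WK + HK - λΘG⁻¹ (`thetaHat_sub_theta`).

The design is deterministic. Two consecutive sweeps through the basis carry opposite signs, so the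
cross terms with the constant regressor cancel and G ≥ mI with m = Nq²/(2d) + λ (`gram_coercive`).
Hence ‖G⁻¹‖ ≤ 1/m and ‖K‖ ≤ 1/√m.

These bounds settle the shrinkage term, and also HK, because the entries of H are at most βq². As K
is not random, v'WKu is sub-Gaussian for fixed unit v and u; quarter-nets of the two spheres and a
union bound control ‖WK‖ (`measureReal_noise_mul_le`). The only random event is this one. -/

namespace LinearizedSysId

/-! ### Quarter-nets of unit spheres -/

section Net

open Metric Module

variable {E : Type*} [NormedAddCommGroup E] [NormedSpace ℝ E]

/-- A quarter-net of the unit sphere: a finite set of unit vectors such that every unit vector is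
within distance `1/4` of one of them. -/
def IsQuarterNet (S : Finset E) : Prop :=
  (∀ v ∈ S, ‖v‖ = 1) ∧ ∀ x : E, ‖x‖ = 1 → ∃ v ∈ S, ‖x - v‖ ≤ 1 / 4

-- Volume comparison: the balls of radius 1/8 about the points are disjoint and lie in the ball of
-- radius 9/8, and the ratio of the radii is 9.
open scoped ENNReal in
theorem card_le_of_quarter_separated [FiniteDimensional ℝ E] (s : Finset E)
    (hs : ∀ c ∈ s, ‖c‖ = 1) (h : ∀ c ∈ s, ∀ d ∈ s, c ≠ d → 1 / 4 ≤ ‖c - d‖) :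
    s.card ≤ 9 ^ finrank ℝ E := by
  borelize E
  let μ : Measure E := Measure.addHaar
  let δ : ℝ := 1 / 8
  let ρ : ℝ := 9 / 8
  have δpos : 0 < δ := by norm_num [δ]
  have ρpos : 0 < ρ := by norm_num [ρ]
  set A := ⋃ c ∈ s, ball (c : E) δ with hA
  have D : Set.Pairwise (s : Set E) (Function.onFun Disjoint fun c => ball (c : E) δ) := by
    rintro c hc d hd hcd
    apply ball_disjoint_ball
    rw [dist_eq_norm]
    refine le_trans ?_ (h c hc d hd hcd)
    norm_num [δ]
  have A_subset : A ⊆ ball (0 : E) ρ := by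
    refine Set.iUnion₂_subset fun x hx => ?_
    apply ball_subset_ball'
    rw [dist_zero_right, hs x hx]
    norm_num [δ, ρ]
  have I : (s.card : ℝ≥0∞) * ENNReal.ofReal (δ ^ finrank ℝ E) * μ (ball 0 1) ≤
      ENNReal.ofReal (ρ ^ finrank ℝ E) * μ (ball 0 1) :=
    calc
      (s.card : ℝ≥0∞) * ENNReal.ofReal (δ ^ finrank ℝ E) * μ (ball 0 1) = μ A := by
        rw [hA, measure_biUnion_finset D fun c _ => measurableSet_ball]
        simp only [μ.addHaar_ball_of_pos _ δpos]
        simp only [Finset.sum_const, nsmul_eq_mul, mul_assoc]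
      _ ≤ μ (ball (0 : E) ρ) := measure_mono A_subset
      _ = ENNReal.ofReal (ρ ^ finrank ℝ E) * μ (ball 0 1) := by
        simp only [μ.addHaar_ball_of_pos _ ρpos]
  have J : (s.card : ℝ≥0∞) * ENNReal.ofReal (δ ^ finrank ℝ E) ≤ ENNReal.ofReal (ρ ^ finrank ℝ E) :=
    (ENNReal.mul_le_mul_iff_left (measure_ball_pos _ _ zero_lt_one).ne' measure_ball_lt_top.ne).1 I
  have K : (s.card : ℝ) ≤ (9 : ℝ) ^ finrank ℝ E := by
    have := ENNReal.toReal_le_of_le_ofReal (pow_nonneg ρpos.le _) J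
    rw [ENNReal.toReal_mul, ENNReal.toReal_natCast,
      ENNReal.toReal_ofReal (pow_nonneg δpos.le _)] at this
    have h9 : ρ = 9 * δ := by norm_num [ρ, δ]
    rw [h9, mul_pow] at this
    exact le_of_mul_le_mul_right this (by positivity)
  exact mod_cast K

/-- In a finite-dimensional normed space there is a quarter-net with at most `9 ^ dim` elements. -/
theorem exists_quarterNet [FiniteDimensional ℝ E] :
    ∃ S : Finset E, IsQuarterNet S ∧ S.card ≤ 9 ^ finrank ℝ E := by
  classical
  -- A separated set of largest cardinality is a net: a unit vector far from all its points could be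
  -- added to it.
  let P : ℕ → Prop := fun k => ∃ s : Finset E, (∀ c ∈ s, ‖c‖ = 1) ∧
    (∀ c ∈ s, ∀ d ∈ s, c ≠ d → 1 / 4 ≤ ‖c - d‖) ∧ s.card = k
  obtain ⟨s, h1, h2, h3⟩ : P (Nat.findGreatest P (9 ^ finrank ℝ E)) :=
    Nat.findGreatest_spec (m := 0) (Nat.zero_le _) ⟨∅, by simp⟩
  refine ⟨s, ⟨h1, fun x hx => ?_⟩, card_le_of_quarter_separated s h1 h2⟩
  by_contra! hfar
  have hxs : x ∉ s := fun hxs => by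
    have := hfar x hxs
    norm_num at this
  have h1' : ∀ c ∈ insert x s, ‖c‖ = 1 := by
    intro c hc
    rcases Finset.mem_insert.1 hc with rfl | hc
    exacts [hx, h1 c hc]
  have h2' : ∀ c ∈ insert x s, ∀ d ∈ insert x s, c ≠ d → 1 / 4 ≤ ‖c - d‖ := by
    intro c hc d hd hcd
    rcases Finset.mem_insert.1 hc with rfl | hc' <;> rcases Finset.mem_insert.1 hd with rfl | hd'
    · exact absurd rfl hcd
    · exact (hfar d hd').le
    · rw [norm_sub_rev]
      exact (hfar c hc').le
    · exact h2 c hc' d hd' hcd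
  have hle := Nat.le_findGreatest (P := P) (card_le_of_quarter_separated _ h1' h2')
    ⟨_, h1', h2', rfl⟩
  rw [Finset.card_insert_of_notMem hxs] at hle
  omega

theorem IsQuarterNet.opNorm_le {F : Type*} [NormedAddCommGroup F] [NormedSpace ℝ F]
    {S : Finset E} (hS : IsQuarterNet S) (T : E →L[ℝ] F) {c : ℝ} (hc : 0 ≤ c)
    (h : ∀ v ∈ S, ‖T v‖ ≤ c) : ‖T‖ ≤ 4 / 3 * c := by
  have key : ‖T‖ ≤ c + ‖T‖ * (1 / 4) := by
    refine ContinuousLinearMap.opNorm_le_of_unit_norm (by positivity) fun x hx => ?_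
    obtain ⟨v, hv, hxv⟩ := hS.2 x hx
    calc ‖T x‖ = ‖T v + T (x - v)‖ := by rw [← map_add, add_sub_cancel]
      _ ≤ ‖T v‖ + ‖T (x - v)‖ := norm_add_le _ _
      _ ≤ c + ‖T‖ * (1 / 4) := add_le_add (h v hv) (T.le_opNorm_of_le hxv)
  linarith

/-- A net point near y/‖y‖ has inner product at least (3/4)‖y‖ with y. -/
theorem IsQuarterNet.norm_le {F : Type*} [NormedAddCommGroup F] [InnerProductSpace ℝ F]
    {S : Finset F} (hS : IsQuarterNet S) (y : F) {c : ℝ} (hc : 0 ≤ c)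
    (h : ∀ v ∈ S, inner ℝ v y ≤ c) : ‖y‖ ≤ 4 / 3 * c := by
  rcases eq_or_ne y 0 with rfl | hy
  · simpa using hc
  have hy' : ‖y‖ ≠ 0 := norm_ne_zero_iff.2 hy
  have hx : ‖‖y‖⁻¹ • y‖ = 1 := by
    rw [norm_smul, norm_inv, norm_norm, inv_mul_cancel₀ hy']
  obtain ⟨v, hv, hxv⟩ := hS.2 _ hx
  have h1 : inner ℝ (‖y‖⁻¹ • y) y = ‖y‖ := by
    rw [real_inner_smul_left, real_inner_self_eq_norm_sq]
    field_simp
  have h2 : inner ℝ (‖y‖⁻¹ • y - v) y ≤ 1 / 4 * ‖y‖ :=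
    (real_inner_le_norm _ _).trans (mul_le_mul_of_nonneg_right hxv (norm_nonneg _))
  rw [inner_sub_left, h1] at h2
  linarith [h v hv]

end Net

/-! ### Spectral norm estimates and the regularized Gram matrix -/

section Matrices

open Matrix

variable {ι κ : Type*} [Fintype ι] [Fintype κ]

theorem norm_toLp_sq (x : ι → ℝ) : ‖WithLp.toLp 2 x‖ ^ 2 = x ⬝ᵥ x := by
  rw [EuclideanSpace.norm_sq_eq, dotProduct]
  exact Finset.sum_congr rfl fun i _ => by simp [sq]

theorem zero_le_dotProduct_self (x : ι → ℝ) : 0 ≤ x ⬝ᵥ x := by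
  rw [← norm_toLp_sq]
  positivity

theorem l2_opNorm_le_of_sq_le [DecidableEq κ] (A : Matrix ι κ ℝ) {C : ℝ} (hC : 0 ≤ C)
    (h : ∀ x, (A *ᵥ x) ⬝ᵥ (A *ᵥ x) ≤ C ^ 2 * (x ⬝ᵥ x)) : ‖A‖ ≤ C := by
  rw [l2_opNorm_def]
  refine ContinuousLinearMap.opNorm_le_bound _ hC fun x => ?_
  refine (sq_le_sq₀ (norm_nonneg _) (by positivity)).1 ?_
  have := h x.ofLp
  rw [← norm_toLp_sq, ← norm_toLp_sq] at this
  rw [mul_pow]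
  exact this

/-- The spectral norm of a matrix is controlled by its bilinear form on quarter-nets. -/
theorem l2_opNorm_le_of_quarterNets [DecidableEq κ] (A : Matrix ι κ ℝ)
    {S : Finset (EuclideanSpace ℝ ι)} (hS : IsQuarterNet S)
    {T : Finset (EuclideanSpace ℝ κ)} (hT : IsQuarterNet T) {c : ℝ} (hc : 0 ≤ c)
    (h : ∀ v ∈ S, ∀ u ∈ T, v.ofLp ⬝ᵥ (A *ᵥ u.ofLp) ≤ c) : ‖A‖ ≤ 16 / 9 * c := by
  rw [l2_opNorm_def]
  -- Each of the two nets costs a factor 1/(1 - 1/4) = 4/3.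
  have := hT.opNorm_le ((toEuclideanLin (𝕜 := ℝ) (m := ι) (n := κ)).trans
    LinearMap.toContinuousLinearMap A) (c := 4 / 3 * c) (by positivity) fun u hu =>
      hS.norm_le _ hc fun v hv => by
        have := h v hv u hu
        rw [dotProduct_comm] at this
        simpa [EuclideanSpace.inner_eq_star_dotProduct] using this
  linarith

/-- The Frobenius bound on the spectral norm, for a matrix with entries at most `b`. -/
theorem l2_opNorm_le_of_entry_le [DecidableEq κ] (A : Matrix ι κ ℝ) {b : ℝ} (hb : 0 ≤ b)
    (h : ∀ i j, |A i j| ≤ b) : ‖A‖ ≤ √(Fintype.card ι * Fintype.card κ) * b := by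
  refine l2_opNorm_le_of_sq_le A (by positivity) fun x => ?_
  rw [mul_pow, Real.sq_sqrt (by positivity)]
  calc (A *ᵥ x) ⬝ᵥ (A *ᵥ x) = ∑ i, (∑ j, A i j * x j) ^ 2 := by
        simp only [dotProduct, mulVec, sq]
    _ ≤ ∑ _i : ι, (Fintype.card κ * b ^ 2) * (x ⬝ᵥ x) := by
        refine Finset.sum_le_sum fun i _ => ?_
        refine (Finset.sum_mul_sq_le_sq_mul_sq _ _ _).trans ?_
        have h1 : ∑ j, A i j ^ 2 ≤ Fintype.card κ * b ^ 2 := by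
          refine (Finset.sum_le_card_nsmul _ _ (b ^ 2) fun j _ => ?_).trans_eq (by simp)
          rw [← sq_abs]
          exact pow_le_pow_left₀ (abs_nonneg _) (h i j) 2
        have h2 : ∑ j, x j ^ 2 = x ⬝ᵥ x := by simp only [dotProduct, sq]
        rw [h2]
        exact mul_le_mul_of_nonneg_right h1 (zero_le_dotProduct_self x)
    _ = Fintype.card ι * Fintype.card κ * b ^ 2 * (x ⬝ᵥ x) := by
        simp only [Finset.sum_const, Finset.card_univ, nsmul_eq_mul]
        ring

section Ridge

variable [DecidableEq ι] (Z : Matrix ι κ ℝ) {lam m : ℝ}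

theorem dotProduct_ridge (x : ι → ℝ) :
    x ⬝ᵥ ((Z * Zᵀ + lam • (1 : Matrix ι ι ℝ)) *ᵥ x)
      = (Zᵀ *ᵥ x) ⬝ᵥ (Zᵀ *ᵥ x) + lam * (x ⬝ᵥ x) := by
  rw [add_mulVec, dotProduct_add, smul_mulVec, one_mulVec, dotProduct_smul, smul_eq_mul,
    ← mulVec_mulVec, dotProduct_mulVec, ← mulVec_transpose]

theorem isUnit_ridge (hm : 0 < m)
    (hZ : ∀ x, m * (x ⬝ᵥ x) ≤ x ⬝ᵥ ((Z * Zᵀ + lam • (1 : Matrix ι ι ℝ)) *ᵥ x)) :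
    IsUnit (Z * Zᵀ + lam • (1 : Matrix ι ι ℝ)) := by
  rw [← mulVec_injective_iff_isUnit]
  intro x y hxy
  have h0 : (Z * Zᵀ + lam • (1 : Matrix ι ι ℝ)) *ᵥ (x - y) = 0 := by
    rw [mulVec_sub]
    exact sub_eq_zero.2 hxy
  have h1 := hZ (x - y)
  rw [h0, dotProduct_zero] at h1
  have h2 : (x - y) ⬝ᵥ (x - y) = 0 :=
    le_antisymm (nonpos_of_mul_nonpos_right h1 hm) (zero_le_dotProduct_self _)
  exact sub_eq_zero.1 (dotProduct_self_eq_zero.1 h2)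

/-- Both bounds follow from m‖x‖² ≤ x·u and 0 ≤ ‖u - mx‖², without any spectral decomposition. -/
theorem ridge_inv_mulVec (hm : 0 < m)
    (hZ : ∀ x, m * (x ⬝ᵥ x) ≤ x ⬝ᵥ ((Z * Zᵀ + lam • (1 : Matrix ι ι ℝ)) *ᵥ x))
    (u : ι → ℝ) :
    ∃ x, (Z * Zᵀ + lam • (1 : Matrix ι ι ℝ))⁻¹ *ᵥ u = x ∧
      (Z * Zᵀ + lam • (1 : Matrix ι ι ℝ)) *ᵥ x = u ∧
      m ^ 2 * (x ⬝ᵥ x) ≤ u ⬝ᵥ u ∧ m * (x ⬝ᵥ u) ≤ u ⬝ᵥ u := by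
  have hu := (isUnit_iff_isUnit_det _).1 (isUnit_ridge Z hm hZ)
  refine ⟨_, rfl, by rw [mulVec_mulVec, mul_nonsing_inv _ hu, one_mulVec], ?_⟩
  set x := (Z * Zᵀ + lam • (1 : Matrix ι ι ℝ))⁻¹ *ᵥ u with hx
  have hGx : (Z * Zᵀ + lam • (1 : Matrix ι ι ℝ)) *ᵥ x = u := by
    rw [hx, mulVec_mulVec, mul_nonsing_inv _ hu, one_mulVec]
  have h1 := hZ x
  rw [hGx] at h1
  have h2 : (u - m • x) ⬝ᵥ (u - m • x) = u ⬝ᵥ u - 2 * m * (x ⬝ᵥ u) + m ^ 2 * (x ⬝ᵥ x) := by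
    simp only [sub_dotProduct, dotProduct_sub, smul_dotProduct, dotProduct_smul, smul_eq_mul,
      dotProduct_comm u x]
    ring
  have h3 := zero_le_dotProduct_self (u - m • x)
  have h4 : m * (m * (x ⬝ᵥ x)) ≤ m * (x ⬝ᵥ u) := mul_le_mul_of_nonneg_left h1 hm.le
  constructor <;> nlinarith

theorem l2_opNorm_ridge_inv_le (hm : 0 < m)
    (hZ : ∀ x, m * (x ⬝ᵥ x) ≤ x ⬝ᵥ ((Z * Zᵀ + lam • (1 : Matrix ι ι ℝ)) *ᵥ x)) :
    ‖(Z * Zᵀ + lam • (1 : Matrix ι ι ℝ))⁻¹‖ ≤ 1 / m := by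
  refine l2_opNorm_le_of_sq_le _ (by positivity) fun u => ?_
  obtain ⟨x, hx, -, h, -⟩ := ridge_inv_mulVec Z hm hZ u
  rw [hx, div_pow, one_pow, one_div, inv_mul_eq_div, le_div_iff₀ (by positivity), mul_comm]
  exact h

/-- With Gx = u, ‖Z'x‖² = x·u - λ‖x‖² ≤ x·u ≤ ‖u‖²/m. -/
theorem dotProduct_transpose_mul_ridge_inv_le (hm : 0 < m)
    (hZ : ∀ x, m * (x ⬝ᵥ x) ≤ x ⬝ᵥ ((Z * Zᵀ + lam • (1 : Matrix ι ι ℝ)) *ᵥ x))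
    (hlam : 0 ≤ lam) (u : ι → ℝ) :
    ((Zᵀ * (Z * Zᵀ + lam • (1 : Matrix ι ι ℝ))⁻¹) *ᵥ u) ⬝ᵥ
      ((Zᵀ * (Z * Zᵀ + lam • (1 : Matrix ι ι ℝ))⁻¹) *ᵥ u) ≤ 1 / m * (u ⬝ᵥ u) := by
  obtain ⟨x, hx, hGx, -, h⟩ := ridge_inv_mulVec Z hm hZ u
  have h1 := dotProduct_ridge Z (lam := lam) x
  rw [hGx] at h1
  rw [← mulVec_mulVec, hx, one_div, inv_mul_eq_div, le_div_iff₀ hm]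
  nlinarith [mul_nonneg hlam (zero_le_dotProduct_self x)]

theorem l2_opNorm_transpose_mul_ridge_inv_le (hm : 0 < m)
    (hZ : ∀ x, m * (x ⬝ᵥ x) ≤ x ⬝ᵥ ((Z * Zᵀ + lam • (1 : Matrix ι ι ℝ)) *ᵥ x))
    (hlam : 0 ≤ lam) :
    ‖Zᵀ * (Z * Zᵀ + lam • (1 : Matrix ι ι ℝ))⁻¹‖ ≤ 1 / √m := by
  refine l2_opNorm_le_of_sq_le _ (by positivity) fun u => ?_
  rw [div_pow, one_pow, Real.sq_sqrt hm.le]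
  exact dotProduct_transpose_mul_ridge_inv_le Z hm hZ hlam u

end Ridge

end Matrices

/-! ### Concentration of the noise term -/

section Noise

open Matrix

variable {Ω : Type*} [MeasurableSpace Ω] {μ : Measure Ω}

/-- The Chernoff bound in deviation form, valid also for a variable that vanishes a.s. -/
theorem HasSubgaussianMGF.measureReal_gt_le {X : Ω → ℝ} {c : ℝ≥0} (h : HasSubgaussianMGF X c μ)
    [IsFiniteMeasure μ] {L : ℝ} (hL : 0 ≤ L) :
    μ.real {ω | √(2 * c * L) < X ω} ≤ Real.exp (-L) := by
  -- For c = 0 the Chernoff exponent would divide by zero. The threshold is then 0, and the strict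
  -- inequality makes the event null.
  rcases eq_or_ne c 0 with rfl | hc
  · have h0 : μ.real {ω | √(2 * (0 : ℝ≥0) * L) < X ω} = 0 := by
      rw [measureReal_eq_zero_iff]
      refine measure_mono_null ?_ h.ae_eq_zero_of_hasSubgaussianMGF_zero
      intro ω hω
      simp only [Set.mem_ofPred_eq, NNReal.coe_zero, mul_zero, zero_mul, Real.sqrt_zero] at hω
      exact hω.ne'
    rw [h0]
    positivity
  · have hc' : (0 : ℝ) < c := by positivity
    refine (measureReal_mono (s₂ := {ω | √(2 * c * L) ≤ X ω})
      (fun ω hω => le_of_lt (show √(2 * c * L) < X ω from hω)) (measure_ne_top μ _)).trans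
      ((h.measure_ge_le (Real.sqrt_nonneg _)).trans_eq ?_)
    rw [Real.sq_sqrt (by positivity)]
    congr 1
    field_simp

/-- The bilinear form is the sum of the independent variables k_t (v·w_t), so its variance proxy is
σ²‖k‖² ≤ σ²r. -/
theorem measureReal_noise_gt_le [IsProbabilityMeasure μ] {n N : ℕ} {σ : ℝ≥0}
    {w : Fin N → Ω → Fin n → ℝ} (hw_indep : iIndepFun w μ)
    (hw_sub : ∀ t, IsSubGaussianVector (w t) σ μ) {v : Fin n → ℝ} (hv : v ⬝ᵥ v = 1)
    (k : Fin N → ℝ) {r L : ℝ} (hk : k ⬝ᵥ k ≤ r) (hL : 0 ≤ L) :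
    μ.real {ω | √(2 * (σ ^ 2 * r) * L) < v ⬝ᵥ (Matrix.of (fun i t => w t ω i) *ᵥ k)}
      ≤ Real.exp (-L) := by
  have hind : iIndepFun (fun t ω => k t * (v ⬝ᵥ w t ω)) μ :=
    hw_indep.comp (fun t (y : Fin n → ℝ) => k t * (v ⬝ᵥ y)) fun t => by
      simp only [dotProduct]
      fun_prop
  have hsum := HasSubgaussianMGF.sum_of_iIndepFun hind (s := Finset.univ)
    fun t _ => (hw_sub t v hv).const_mul (k t)
  have hX : ∀ ω, v ⬝ᵥ (Matrix.of (fun i t => w t ω i) *ᵥ k) = ∑ t, k t * (v ⬝ᵥ w t ω) := by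
    intro ω
    simp only [dotProduct, mulVec, of_apply, Finset.mul_sum]
    rw [Finset.sum_comm]
    exact Finset.sum_congr rfl fun t _ => Finset.sum_congr rfl fun i _ => by ring
  refine (measureReal_mono fun ω hω => ?_).trans (HasSubgaussianMGF.measureReal_gt_le hsum hL)
  simp only [Set.mem_ofPred_eq, hX] at hω ⊢
  refine lt_of_le_of_lt (Real.sqrt_le_sqrt ?_) hω
  refine mul_le_mul_of_nonneg_right (mul_le_mul_of_nonneg_left ?_ (by norm_num)) hL
  rw [NNReal.coe_sum]
  calc ∑ t, k t ^ 2 * ((σ ^ 2 : ℝ≥0) : ℝ) = σ ^ 2 * (k ⬝ᵥ k) := by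
        rw [← Finset.sum_mul, mul_comm, NNReal.coe_pow]
        simp only [dotProduct, sq]
    _ ≤ σ ^ 2 * r := by gcongr

/-- Covering bound for the noise: with probability at least `1 - δ`, the spectral norm of
`W K` is of the order of the norm of `K` times the square root of the dimensions. -/
theorem measureReal_noise_mul_le [IsProbabilityMeasure μ] {n N D : ℕ} {σ : ℝ≥0}
    {w : Fin N → Ω → Fin n → ℝ} (hw_indep : iIndepFun w μ)
    (hw_sub : ∀ t, IsSubGaussianVector (w t) σ μ) (K : Matrix (Fin N) (Fin D) ℝ) {r δ : ℝ}
    (hK : ∀ u, (K *ᵥ u) ⬝ᵥ (K *ᵥ u) ≤ r * (u ⬝ᵥ u)) (hδ : 0 < δ) (hδ1 : δ < 1) :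
    μ.real {ω | ¬ ‖(Matrix.of fun i t => w t ω i) * K‖ ≤
      16 / 9 * √(2 * (σ ^ 2 * r) * (Real.log (9 ^ n / δ) + D * Real.log 9))} ≤ δ := by
  obtain ⟨S, hS, hSc⟩ := exists_quarterNet (E := EuclideanSpace ℝ (Fin n))
  obtain ⟨T, hT, hTc⟩ := exists_quarterNet (E := EuclideanSpace ℝ (Fin D))
  rw [finrank_euclideanSpace_fin] at hSc hTc
  -- Chosen so that exp(-L), times the at most 9^n · 9^D pairs of net points, is at most δ.
  set L := Real.log (9 ^ n / δ) + D * Real.log 9 with hLdef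
  have h9 : (1 : ℝ) ≤ 9 ^ n := one_le_pow₀ (by norm_num)
  have hL : 0 ≤ L := by
    have h1 : 0 ≤ Real.log (9 ^ n / δ) := Real.log_nonneg (by rw [le_div_iff₀ hδ]; linarith)
    have h2 : 0 ≤ Real.log 9 := Real.log_nonneg (by norm_num)
    positivity
  have hexp : Real.exp (-L) = δ / (9 ^ n * 9 ^ D) := by
    rw [Real.exp_neg, hLdef, Real.exp_add, Real.exp_log (by positivity), ← Real.log_pow,
      Real.exp_log (by positivity)]
    field_simp
  let B : EuclideanSpace ℝ (Fin n) × EuclideanSpace ℝ (Fin D) → Set Ω := fun vu =>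
    {ω | √(2 * (σ ^ 2 * r) * L) <
      vu.1.ofLp ⬝ᵥ (Matrix.of (fun i t => w t ω i) *ᵥ (K *ᵥ vu.2.ofLp))}
  have hunit : ∀ {d : ℕ} {v : EuclideanSpace ℝ (Fin d)}, ‖v‖ = 1 → v.ofLp ⬝ᵥ v.ofLp = 1 := by
    intro d v hv
    rw [← norm_toLp_sq]
    change ‖v‖ ^ 2 = 1
    rw [hv, one_pow]
  have hB : ∀ vu ∈ S ×ˢ T, μ.real (B vu) ≤ δ / (9 ^ n * 9 ^ D) := by
    rintro ⟨v, u⟩ hvu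
    rw [Finset.mem_product] at hvu
    rw [← hexp]
    refine measureReal_noise_gt_le hw_indep hw_sub (hunit (hS.1 v hvu.1)) _ ?_ hL
    have := hK u.ofLp
    rwa [hunit (hT.1 u hvu.2), mul_one] at this
  calc _ ≤ μ.real (⋃ vu ∈ S ×ˢ T, B vu) := by
        refine measureReal_mono (fun ω hω => ?_) (measure_ne_top μ _)
        by_contra hnot
        refine hω (l2_opNorm_le_of_quarterNets _ hS hT (Real.sqrt_nonneg _) fun v hv u hu => ?_)
        by_contra hlt
        refine hnot (Set.mem_biUnion (x := (v, u)) (Finset.mem_product.2 ⟨hv, hu⟩) ?_)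
        rw [← mulVec_mulVec, not_le] at hlt
        exact hlt
    _ ≤ ∑ vu ∈ S ×ˢ T, μ.real (B vu) := measureReal_biUnion_finset_le _ _
    _ ≤ (S ×ˢ T).card • (δ / (9 ^ n * 9 ^ D)) := Finset.sum_le_card_nsmul _ _ _ hB
    _ ≤ (9 ^ n * 9 ^ D) * (δ / (9 ^ n * 9 ^ D)) := by
        rw [nsmul_eq_mul, Finset.card_product]
        refine mul_le_mul_of_nonneg_right ?_ (by positivity)
        exact_mod_cast Nat.mul_le_mul hSc hTc
    _ = δ := by field_simp

end Noise


/-! ### Excitation by alternating sweeps through the basis -/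

section Scheme

theorem sign_succ (d t : ℕ) : sign d (t + 1) = (-1) ^ (t / d) := by
  induction t with
  | zero => simp [sign]
  | succ t ih =>
    rw [sign, ih, Nat.succ_div]
    by_cases h : d ∣ t + 1
    · simp [h, Nat.mod_eq_zero_of_dvd h, pow_succ]
    · have h' : (t + 1) % d ≠ 0 := fun h0 => h (Nat.dvd_of_mod_eq_zero h0)
      simp [h, h']

/-- Counting experiments and coordinates from 0 merges the two branches of the scheme: t % d is the
coordinate and t / d the number of completed sweeps. -/
theorem initialCondition_succ {d : ℕ} (hd : 0 < d) (q : ℝ) (t : ℕ) :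
    initialCondition d q (t + 1)
      = Pi.single (⟨t % d, Nat.mod_lt t hd⟩ : Fin d) ((-1) ^ (t / d) * q) := by
  have hlt := Nat.mod_lt t hd
  have hmod : (t + 1) % d = (t % d + 1) % d := (Nat.mod_add_mod t d 1).symm
  have key : ∀ m, m = t % d + 1 → ((-1) ^ (t / d) * q) • basisVec d m
      = Pi.single (⟨t % d, hlt⟩ : Fin d) ((-1) ^ (t / d) * q) := by
    rintro m rfl
    ext j
    by_cases hj : j = ⟨t % d, hlt⟩
    · subst hj
      simp [basisVec]
    · have hj' : (j : ℕ) ≠ t % d := fun h => hj (Fin.ext h)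
      simp [basisVec, hj, hj']
  rw [initialCondition, sign_succ]
  rcases Nat.lt_or_ge (t % d + 1) d with h | h
  · rw [hmod, Nat.mod_eq_of_lt h, if_pos (Nat.succ_ne_zero _)]
    exact key _ rfl
  · have h' : t % d + 1 = d := by omega
    rw [hmod, h', Nat.mod_self, if_neg (by simp)]
    exact key _ h'.symm

theorem l1Norm_initialCondition {d : ℕ} (hd : 0 < d) {q : ℝ} (hq : 0 < q) (t : ℕ) :
    l1Norm (initialCondition d q (t + 1)) = q := by
  rw [initialCondition_succ hd, l1Norm,
    Finset.sum_eq_single (⟨t % d, Nat.mod_lt t hd⟩ : Fin d)]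
  · simp [abs_mul, abs_of_pos hq]
  · intro j _ hj
    simp [hj]
  · simp

/-- Each coordinate contributes (qa + b)² + (-qa + b)², where the cross terms cancel. -/
theorem sum_two_sweeps {d : ℕ} (hd : 0 < d) (q b : ℝ) (a : Fin d → ℝ) :
    ∑ t ∈ Finset.range (d + d), ((-1) ^ (t / d) * q * a ⟨t % d, Nat.mod_lt t hd⟩ + b) ^ 2
      = 2 * (q ^ 2 * ∑ j, a j ^ 2 + d * b ^ 2) := by
  rw [Finset.sum_range_add, Finset.sum_range, Finset.sum_range, ← Finset.sum_add_distrib]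
  have h : ∀ j : Fin d, ((-1) ^ ((j : ℕ) / d) * q * a ⟨(j : ℕ) % d, Nat.mod_lt _ hd⟩ + b) ^ 2
      + ((-1) ^ ((d + (j : ℕ)) / d) * q * a ⟨(d + (j : ℕ)) % d, Nat.mod_lt _ hd⟩ + b) ^ 2
      = 2 * q ^ 2 * a j ^ 2 + 2 * b ^ 2 := by
    intro j
    have h1 : (j : ℕ) / d = 0 := Nat.div_eq_of_lt j.2
    have h2 : (d + (j : ℕ)) / d = 1 := by rw [Nat.add_div_left _ hd, h1]
    have h3 : (j : ℕ) % d = j := Nat.mod_eq_of_lt j.2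
    have h4 : (d + (j : ℕ)) % d = j := by rw [Nat.add_mod_left, h3]
    simp only [h1, h2, h3, h4, Fin.eta]
    ring
  rw [Finset.sum_congr rfl fun j _ => h j, Finset.sum_add_distrib, ← Finset.mul_sum]
  simp only [Finset.sum_const, Finset.card_univ, Fintype.card_fin, nsmul_eq_mul]
  ring

theorem sum_sweeps {d : ℕ} (hd : 0 < d) (q b : ℝ) (a : Fin d → ℝ) (M : ℕ) :
    ∑ t ∈ Finset.range (M * (d + d)),
        ((-1) ^ (t / d) * q * a ⟨t % d, Nat.mod_lt t hd⟩ + b) ^ 2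
      = M * (2 * (q ^ 2 * ∑ j, a j ^ 2 + d * b ^ 2)) := by
  induction M with
  | zero => simp
  | succ M ih =>
    rw [Nat.succ_mul, Finset.sum_range_add, ih]
    have h : ∀ t, ((-1) ^ ((M * (d + d) + t) / d) * q
        * a ⟨(M * (d + d) + t) % d, Nat.mod_lt _ hd⟩ + b) ^ 2
        = ((-1) ^ (t / d) * q * a ⟨t % d, Nat.mod_lt _ hd⟩ + b) ^ 2 := by
      intro t
      have h0 : M * (d + d) + t = t + d * (2 * M) := by ring
      have h1 : (M * (d + d) + t) / d = t / d + 2 * M := by rw [h0, Nat.add_mul_div_left _ _ hd]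
      have h2 : (M * (d + d) + t) % d = t % d := by rw [h0, Nat.add_mul_mod_self_left]
      simp only [h1, h2, pow_add, pow_mul, neg_one_sq, one_pow, mul_one]
    rw [Finset.sum_congr rfl fun t _ => h t, sum_two_sweeps hd]
    push_cast
    ring

/-- The excitation of the data acquisition scheme after `N ≥ 2 d` experiments. -/
theorem excitation_le_sum {d N : ℕ} (hd : 0 < d) (hN : 2 * d ≤ N) {q : ℝ} (hq : q ^ 2 ≤ d) (b : ℝ)
    (a : Fin d → ℝ) :
    N * q ^ 2 / (2 * d) * (∑ j, a j ^ 2 + b ^ 2) ≤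
      ∑ t ∈ Finset.range N, ((-1) ^ (t / d) * q * a ⟨t % d, Nat.mod_lt t hd⟩ + b) ^ 2 := by
  have hd' : (0 : ℝ) < d := by exact_mod_cast hd
  -- M counts the complete double sweeps. As M ≥ 1, N < 2d(M + 1) ≤ 4dM, so dropping the incomplete
  -- one costs at most a factor 2.
  set M := N / (d + d) with hM
  have hM1 : 1 ≤ M := (Nat.one_le_div_iff (by omega)).2 (by omega)
  have hMN : M * (d + d) ≤ N := Nat.div_mul_le_self _ _
  have hN4 : N ≤ 4 * d * M := by
    have h1 := Nat.lt_div_mul_add (a := N) (b := d + d) (by omega)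
    rw [← hM] at h1
    nlinarith
  have hN4' : (N : ℝ) / (2 * d) ≤ 2 * M := by
    rw [div_le_iff₀ (by positivity)]
    have : (N : ℝ) ≤ 4 * d * M := by exact_mod_cast hN4
    linarith
  have hS : 0 ≤ ∑ j, a j ^ 2 := Finset.sum_nonneg fun j _ => sq_nonneg _
  calc N * q ^ 2 / (2 * d) * (∑ j, a j ^ 2 + b ^ 2)
      = N / (2 * d) * (q ^ 2 * ∑ j, a j ^ 2 + q ^ 2 * b ^ 2) := by ring
    _ ≤ 2 * M * (q ^ 2 * ∑ j, a j ^ 2 + d * b ^ 2) := by gcongr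
    _ = ∑ t ∈ Finset.range (M * (d + d)),
        ((-1) ^ (t / d) * q * a ⟨t % d, Nat.mod_lt t hd⟩ + b) ^ 2 := by
        rw [sum_sweeps hd]
        ring
    _ ≤ _ := Finset.sum_le_sum_of_subset_of_nonneg (Finset.range_subset_range.2 hMN)
        fun t _ _ => sq_nonneg _

end Scheme

/-! ### Error decomposition of the estimator -/

section Regression

open Matrix

variable {n p N : ℕ} {q : ℝ}

theorem regZ_transpose_mulVec (hd : 0 < n + p) (x : Fin (n + p + 1) → ℝ) (t : Fin N) :
    ((regZ n p N q)ᵀ *ᵥ x) t = (-1) ^ ((t : ℕ) / (n + p)) * q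
      * x (Fin.castSucc ⟨(t : ℕ) % (n + p), Nat.mod_lt _ hd⟩) + x (Fin.last _) := by
  simp only [mulVec, dotProduct, transpose_apply, regZ, of_apply, initialCondition_succ hd,
    Fin.sum_univ_castSucc, Fin.snoc_castSucc, Fin.snoc_last, one_mul]
  rw [Finset.sum_eq_single (⟨(t : ℕ) % (n + p), Nat.mod_lt _ hd⟩ : Fin (n + p))]
  · simp
  · intro j _ hj
    simp [hj]
  · simp

theorem gram_coercive (hd : 0 < n + p) (hN : 2 * (n + p) ≤ N) (hq : q ^ 2 ≤ (n : ℝ) + p) (lam : ℝ)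
    (x : Fin (n + p + 1) → ℝ) :
    (N * q ^ 2 / (2 * ((n : ℝ) + p)) + lam) * (x ⬝ᵥ x) ≤
      x ⬝ᵥ ((regZ n p N q * (regZ n p N q)ᵀ
        + lam • (1 : Matrix (Fin (n + p + 1)) (Fin (n + p + 1)) ℝ)) *ᵥ x) := by
  rw [dotProduct_ridge, add_mul]
  refine add_le_add_left ?_ _
  have h := excitation_le_sum hd hN (q := q) (by push_cast; exact hq) (x (Fin.last _))
    fun j => x j.castSucc
  rw [Finset.sum_range] at h
  push_cast at h
  convert h using 1
  · congr 1
    simp only [dotProduct, Fin.sum_univ_castSucc, sq]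
  · simp only [dotProduct]
    refine Finset.sum_congr rfl fun t _ => ?_
    rw [regZ_transpose_mulVec hd, sq]

theorem theta_mul_regZ (f : (Fin (n + p) → ℝ) → (Fin n → ℝ)) (i : Fin n) (t : Fin N) :
    (theta f * regZ n p N q) i t =
      (matA f *ᵥ statePart (initialCondition (n + p) q ((t : ℕ) + 1))
        + matB f *ᵥ inputPart (initialCondition (n + p) q ((t : ℕ) + 1)) + offset f) i := by
  simp only [mul_apply, theta, regZ, of_apply, Fin.sum_univ_castSucc, Fin.snoc_castSucc,
    Fin.snoc_last, mul_one, Fin.sum_univ_add, Fin.append_left, Fin.append_right, Pi.add_apply,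
    mulVec, dotProduct, statePart, inputPart]

/-- The matrix of the remainders along the experiments. -/
noncomputable def remainderMatrix (f : (Fin (n + p) → ℝ) → (Fin n → ℝ)) (N : ℕ) (q : ℝ) :
    Matrix (Fin n) (Fin N) ℝ :=
  Matrix.of fun i t => remainder f (initialCondition (n + p) q ((t : ℕ) + 1)) i

theorem dataX_eq (f : (Fin (n + p) → ℝ) → (Fin n → ℝ)) (w : Fin N → Fin n → ℝ) :
    dataX f q w = theta f * regZ n p N q + remainderMatrix f N q + Matrix.of fun i t => w t i := by
  ext i t
  rw [Matrix.add_apply, Matrix.add_apply, theta_mul_regZ]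
  simp only [dataX, remainderMatrix, of_apply, remainder, Pi.sub_apply]
  ring

theorem thetaHat_sub_theta (f : (Fin (n + p) → ℝ) → (Fin n → ℝ)) {lam : ℝ}
    (w : Fin N → Fin n → ℝ) (hG : IsUnit (gram n p N q lam)) :
    thetaHat f q lam w - theta f =
      (Matrix.of fun i t => w t i) * ((regZ n p N q)ᵀ * (gram n p N q lam)⁻¹)
      + remainderMatrix f N q * ((regZ n p N q)ᵀ * (gram n p N q lam)⁻¹)
      - lam • (theta f * (gram n p N q lam)⁻¹) := by
  have hdet := (isUnit_iff_isUnit_det _).1 hG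
  have h1 : theta f * regZ n p N q * (regZ n p N q)ᵀ * (gram n p N q lam)⁻¹
      = theta f - lam • (theta f * (gram n p N q lam)⁻¹) := by
    have h2 : regZ n p N q * (regZ n p N q)ᵀ = gram n p N q lam - lam • 1 := by
      rw [gram, add_sub_cancel_right]
    rw [Matrix.mul_assoc (theta f), h2, Matrix.mul_assoc, Matrix.sub_mul, mul_nonsing_inv _ hdet,
      Matrix.mul_sub, Matrix.mul_one, smul_mul, Matrix.one_mul, Matrix.mul_smul]
  rw [thetaHat, dataX_eq, Matrix.add_mul, Matrix.add_mul, Matrix.add_mul, Matrix.add_mul, h1,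
    Matrix.mul_assoc (remainderMatrix f N q), Matrix.mul_assoc (Matrix.of fun i t => w t i)]
  abel

/-- The bound is evaluated at one initial condition; `0 < n` provides a component to evaluate. -/
theorem RemainderBound.nonneg {f : (Fin (n + p) → ℝ) → (Fin n → ℝ)} {c β : ℝ}
    (h : RemainderBound f c β) (hq : 0 < q) (hqc : q < c) (hn : 0 < n) : 0 ≤ β := by
  have hl := l1Norm_initialCondition (Nat.add_pos_left hn p) hq 0
  have h1 := (abs_nonneg _).trans (h.2 _ (hl.trans_lt hqc) ⟨0, hn⟩)
  rw [hl] at h1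
  exact nonneg_of_mul_nonneg_left h1 (by positivity)

theorem norm_remainderMatrix_le {f : (Fin (n + p) → ℝ) → (Fin n → ℝ)} {c β : ℝ}
    (h : RemainderBound f c β) (hq : 0 < q) (hqc : q < c) (hβ : 0 ≤ β) (hd : 0 < n + p) :
    ‖remainderMatrix f N q‖ ≤ √(n * N) * (β * q ^ 2) := by
  have := l2_opNorm_le_of_entry_le (remainderMatrix f N q) (b := β * q ^ 2) (by positivity)
    fun i t => by
      have hl := l1Norm_initialCondition hd hq t
      have h1 := h.2 _ (hl.trans_lt hqc) i
      rwa [hl] at h1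
  simpa only [Fintype.card_fin] using this

end Regression

/-! ### Comparison with the stated constants -/

section Constants

/-- Q ≥ 4 trades the net entropy for the stated logarithm: log 9 ≤ (3/2) log 5 ≤ (3/2) log(1 + Q).
With 1/m ≤ 2/m', the squared constant is (16/9)² · 6 < 25. -/
theorem noise_term_le {L D l Q m m' σ : ℝ} (hσ : 0 ≤ σ) (hL : 0 ≤ L) (hD : 0 ≤ D) (hm' : 0 < m')
    (hm : m' ≤ 2 * m) (hQ : 4 ≤ Q) (hl : l = Real.log (1 + Q)) :
    16 / 9 * √(2 * (σ ^ 2 * (1 / m)) * (L + D * Real.log 9)) ≤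
      5 * σ * √(L + D * l) / √m' := by
  have hm0 : 0 < m := by linarith
  have hl5 : Real.log 5 ≤ l := hl ▸ Real.log_le_log (by norm_num) (by linarith)
  have h9 : 2 * Real.log 9 ≤ 3 * Real.log 5 := by
    rw [show 2 * Real.log 9 = Real.log (9 ^ 2) by rw [Real.log_pow]; norm_num,
      show 3 * Real.log 5 = Real.log (5 ^ 3) by rw [Real.log_pow]; norm_num]
    exact Real.log_le_log (by norm_num) (by norm_num)
  have hlog9 : 0 < Real.log 9 := Real.log_pos (by norm_num)
  have hsum : L + D * Real.log 9 ≤ 3 / 2 * (L + D * l) := by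
    have := mul_le_mul_of_nonneg_left (show Real.log 9 ≤ 3 / 2 * l by linarith) hD
    linarith
  have hinv : 1 / m ≤ 2 / m' := by
    rw [div_le_div_iff₀ hm0 hm']
    linarith
  have hpos : 0 ≤ L + D * Real.log 9 := by positivity
  have hl0 : 0 ≤ l := by linarith
  have hpos' : 0 ≤ L + D * l := by positivity
  have hmain : 2 * (σ ^ 2 * (1 / m)) * (L + D * Real.log 9) ≤ 6 * σ ^ 2 * (L + D * l) / m' := by
    calc 2 * (σ ^ 2 * (1 / m)) * (L + D * Real.log 9)
        ≤ 2 * (σ ^ 2 * (2 / m')) * (3 / 2 * (L + D * l)) := by gcongr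
      _ = 6 * σ ^ 2 * (L + D * l) / m' := by ring
  refine (pow_le_pow_iff_left₀ (by positivity) (by positivity) two_ne_zero).1 ?_
  rw [mul_pow, Real.sq_sqrt (by positivity), div_pow _ (√m'), mul_pow, mul_pow,
    Real.sq_sqrt hpos', Real.sq_sqrt hm'.le]
  have hX : 0 ≤ σ ^ 2 * (L + D * l) / m' := by positivity
  calc (16 / 9) ^ 2 * (2 * (σ ^ 2 * (1 / m)) * (L + D * Real.log 9))
      ≤ (16 / 9) ^ 2 * (6 * σ ^ 2 * (L + D * l) / m') := by gcongr
    _ = (16 / 9) ^ 2 * 6 * (σ ^ 2 * (L + D * l) / m') := by ring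
    _ ≤ 25 * (σ ^ 2 * (L + D * l) / m') := by
        refine mul_le_mul_of_nonneg_right (by norm_num) hX
    _ = 5 ^ 2 * σ ^ 2 * (L + D * l) / m' := by ring

/-- After squaring, this is Nq²(1 + γ) = Nq² + λd ≤ 2dm. -/
theorem remainder_term_le {n N d q lam β γ m : ℝ} (hn : 0 ≤ n) (hN : 0 < N) (hd : 0 < d)
    (hq : 0 < q) (hlam : 0 ≤ lam) (hβ : 0 ≤ β) (hγ : γ = lam * d / (N * q ^ 2))
    (hm : m = N * q ^ 2 / (2 * d) + lam) :
    √(n * N) * (β * q ^ 2) * (1 / √m) ≤ √(2 * (n * d) / (1 + γ)) * β * q := by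
  have hm0 : 0 < m := hm ▸ by positivity
  have hγ0 : 0 ≤ γ := hγ ▸ by positivity
  have hmγ : N * q ^ 2 * (1 + γ) ≤ 2 * d * m := by
    have h1 : N * q ^ 2 * γ = lam * d := by rw [hγ]; field_simp
    have h2 : 2 * d * m = N * q ^ 2 + 2 * (lam * d) := by rw [hm]; field_simp
    have h3 : 0 ≤ lam * d := by positivity
    linarith
  have key : √(n * N) * q / √m ≤ √(2 * (n * d) / (1 + γ)) := by
    refine (pow_le_pow_iff_left₀ (by positivity) (by positivity) two_ne_zero).1 ?_
    rw [div_pow, mul_pow, Real.sq_sqrt (by positivity), Real.sq_sqrt hm0.le,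
      Real.sq_sqrt (by positivity), div_le_div_iff₀ hm0 (by positivity)]
    have := mul_le_mul_of_nonneg_left hmγ hn
    linarith
  calc √(n * N) * (β * q ^ 2) * (1 / √m) = √(n * N) * q / √m * (β * q) := by ring
    _ ≤ √(2 * (n * d) / (1 + γ)) * (β * q) := by gcongr
    _ = _ := by ring

/-- The right-hand side is (λθ + r)/m, so r ≥ 0 is mere slack. -/
theorem shrinkage_term_le {N d q lam θ r m : ℝ} (hN : 0 < N) (hd : 0 < d) (hq : 0 < q)
    (hlam : 0 ≤ lam) (hr : 0 ≤ r) (hm : m = N * q ^ 2 / (2 * d) + lam) :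
    lam * (θ * (1 / m)) ≤ 2 * d * (lam * θ + r) / (2 * lam * d + N * q ^ 2) := by
  have h2 : 2 * lam * d + N * q ^ 2 = 2 * d * m := by rw [hm]; field_simp; ring
  have hm0 : 0 < m := hm ▸ by positivity
  rw [h2, mul_div_mul_left _ _ (by positivity), le_div_iff₀ hm0]
  have : lam * (θ * (1 / m)) * m = lam * θ := by field_simp
  linarith

end Constants

end LinearizedSysId

/-! ### Assembly of the three error terms -/

open LinearizedSysId
theorem theorem1 {Ω : Type*} [MeasurableSpace Ω] (μ : Measure Ω) [IsProbabilityMeasure μ]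
    (n p N : ℕ) (f : (Fin (n + p) → ℝ) → (Fin n → ℝ)) (hf : ContDiff ℝ 2 f)
    (σw : ℝ≥0) (w : Fin N → Ω → Fin n → ℝ) (hw_meas : ∀ t, Measurable (w t))
    (hw_indep : iIndepFun w μ) (hw_sub : ∀ t, IsSubGaussianVector (w t) σw μ)
    (q lam c β δ γ : ℝ) (hq : 0 < q) (hlam : 0 ≤ lam)
    (hN : 4 * (n + p) ≤ N) (hq_le : q ≤ √((n : ℝ) + p))
    (hrem : RemainderBound f c β) (hqc : q < c) (hδ : δ ∈ Set.Ioo (0 : ℝ) 1)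
    (hγ : γ = lam * ((n : ℝ) + p) / (N * q ^ 2)) :
    IsUnit (gram n p N q lam) ∧
    1 - δ ≤ μ.real {ω | ‖thetaHat f q lam (fun t => w t ω) - theta f‖ ≤
      5 * σw * √(Real.log (9 ^ n / δ)
          + ((n : ℝ) + p + 1) * Real.log (1 + 4 * ((n : ℝ) + p) / q ^ 2))
        / √(N * q ^ 2 / ((n : ℝ) + p) + lam)
      + √(2 * ((n : ℝ) ^ 2 + n * p) / (1 + γ)) * β * q
      + 2 * ((n : ℝ) + p) * (lam * ‖theta f‖ + √(lam * N * n * β ^ 2 * q ^ 4))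
        / (2 * lam * ((n : ℝ) + p) + N * q ^ 2)} := by
  have hd' : 0 < (n : ℝ) + p := Real.sqrt_pos.1 (hq.trans_le hq_le)
  have hd : 0 < n + p := by exact_mod_cast hd'
  have hN0 : (0 : ℝ) < N := by
    have : 0 < N := by omega
    exact_mod_cast this
  have hq2 : q ^ 2 ≤ (n : ℝ) + p :=
    (pow_le_pow_left₀ hq.le hq_le 2).trans_eq (Real.sq_sqrt hd'.le)
  set d : ℝ := (n : ℝ) + p with hd_def
  set m : ℝ := N * q ^ 2 / (2 * d) + lam with hm
  have hm0 : 0 < m := by positivity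
  have hcoer := gram_coercive hd (by omega) hq2 lam (N := N)
  rw [← hm] at hcoer
  have hG : IsUnit (gram n p N q lam) := isUnit_ridge _ hm0 hcoer
  refine ⟨hG, ?_⟩
  set K := (regZ n p N q)ᵀ * (gram n p N q lam)⁻¹ with hK
  have hKnorm : ‖K‖ ≤ 1 / √m := l2_opNorm_transpose_mul_ridge_inv_le _ hm0 hcoer hlam
  have hGnorm : ‖(gram n p N q lam)⁻¹‖ ≤ 1 / m := l2_opNorm_ridge_inv_le _ hm0 hcoer
  have hbad := measureReal_noise_mul_le hw_indep hw_sub K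
    (dotProduct_transpose_mul_ridge_inv_le _ hm0 hcoer hlam) hδ.1 hδ.2
  have hnoise := noise_term_le (L := Real.log (9 ^ n / δ)) (D := ((n + p + 1 : ℕ) : ℝ))
    (l := Real.log (1 + 4 * d / q ^ 2)) (Q := 4 * d / q ^ 2) (m := m)
    (m' := N * q ^ 2 / d + lam) (σ := σw) σw.2
    (Real.log_nonneg (by
      rw [le_div_iff₀ hδ.1, one_mul]
      exact hδ.2.le.trans (one_le_pow₀ (by norm_num)))) (by positivity) (by positivity)
    (by
      have : 2 * m = N * q ^ 2 / d + 2 * lam := by rw [hm]; field_simp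
      linarith)
    (by rw [le_div_iff₀ (by positivity)]; linarith) rfl
  have hremainder : ‖remainderMatrix f N q * K‖ ≤
      √(2 * ((n : ℝ) ^ 2 + n * p) / (1 + γ)) * β * q := by
    -- For n = 0 the sign of β is unknown, but both sides vanish.
    rcases Nat.eq_zero_or_pos n with rfl | hn
    · rw [Subsingleton.elim (remainderMatrix f N q * K) 0]
      simp
    · have hβ := hrem.nonneg hq hqc hn
      rw [show (n : ℝ) ^ 2 + n * p = n * d by rw [hd_def]; ring]
      refine le_trans ?_
        (remainder_term_le (Nat.cast_nonneg n) hN0 hd' hq hlam hβ hγ hm)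
      exact (Matrix.l2_opNorm_mul _ _).trans (mul_le_mul (norm_remainderMatrix_le hrem hq hqc hβ hd)
        hKnorm (norm_nonneg _) (by positivity))
  have hshrink : ‖lam • (theta f * (gram n p N q lam)⁻¹)‖ ≤
      2 * d * (lam * ‖theta f‖ + √(lam * N * n * β ^ 2 * q ^ 4)) / (2 * lam * d + N * q ^ 2) := by
    refine le_trans ?_ (shrinkage_term_le hN0 hd' hq hlam (Real.sqrt_nonneg _) hm)
    rw [norm_smul, Real.norm_of_nonneg hlam]
    exact mul_le_mul_of_nonneg_left ((Matrix.l2_opNorm_mul _ _).trans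
      (mul_le_mul_of_nonneg_left hGnorm (norm_nonneg _))) hlam
  have hD : ((n + p + 1 : ℕ) : ℝ) = d + 1 := by push_cast; rfl
  rw [hD] at hnoise hbad
  set good := {ω | ‖(Matrix.of fun i t => w t ω i) * K‖ ≤ 16 / 9 * √(2 * ((σw : ℝ) ^ 2 * (1 / m))
    * (Real.log (9 ^ n / δ) + (d + 1) * Real.log 9))} with hgood
  -- Subadditivity suffices here, so measurability of `good` is not needed.
  have hcover : 1 ≤ μ.real good + μ.real goodᶜ := by
    have := measureReal_union_le (μ := μ) good goodᶜ
    rwa [Set.union_compl_self, probReal_univ] at this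
  have hbad' : μ.real goodᶜ ≤ δ := hbad
  have hsub : μ.real good ≤ _ := measureReal_mono (μ := μ) (s₂ := {ω |
      ‖thetaHat f q lam (fun t => w t ω) - theta f‖ ≤
      5 * σw * √(Real.log (9 ^ n / δ) + (d + 1) * Real.log (1 + 4 * d / q ^ 2))
        / √(N * q ^ 2 / d + lam)
      + √(2 * ((n : ℝ) ^ 2 + n * p) / (1 + γ)) * β * q
      + 2 * d * (lam * ‖theta f‖ + √(lam * N * n * β ^ 2 * q ^ 4))
        / (2 * lam * d + N * q ^ 2)}) (fun ω hω => by
    have hω' := (show _ ≤ _ from hω).trans hnoise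
    rw [Set.mem_ofPred_eq, thetaHat_sub_theta f _ hG]
    exact (norm_sub_le _ _).trans (add_le_add ((norm_add_le _ _).trans
      (add_le_add hω' hremainder)) hshrink)) (measure_ne_top μ _)
  linarith
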